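/- Let $X$ and $Y$ be real Banach spaces with $X$ reflexive, and let $Z$ be a closed subspace of $Y$. Write $S_X$ for the unit sphere of $X$, $E_X$ for the set of extreme points of the closed unit ball of $X$, $\mathcal{L}(X,Y)$ for the space of bounded linear operators with the operator norm, and $d(v,W)=\inf_{w\in W}\|v-w\|$. For a vector $v$ and a subspace $W$ of a real normed space, $v\perp_B W$ means that $\|v+\lambda w\|\ge\|v\|$ for all $w\in W$ and $\lambda\in\mathbb{R}$. Regard $Y$ as canonically embedded in $Y^{**}$, let $Z^\perp=\{y^*\in Y^*: y^*(z)=0\ \forall z\in Z\}$ and $Z^{\perp\perp}=\{u\in Y^{**}: u(y^*)=0\ \forall y^*\in Z^\perp\}$; regard $\mathcal{L}(X,Z)$ as a subspace of $\mathcal{L}(X,Y)$, and $\mathcal{L}(X,Y)$ and $\mathcal{L}(X,Z^{\perp\perp})$ as subspaces of $\mathcal{L}(X,Y^{**})$. Let $T\in\mathcal{L}(X,Y)$ be a non-zero compact operator that is multi-smooth of finite order, i.e. the linear span of $J(T)=\{f\in\mathcal{L}(X,Y)^*:\|f\|=1,\ f(T)=\|T\|\}$ is finite-dimensional. Let $M_T=\{x\in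 S_X:\|Tx\|=\|T\|\}$, and suppose that $M_T\cap E_X=\{\pm x_i:1\le i\le n\}$ with $x_1,\dots,x_n$ linearly independent, and that $T\perp_B\mathcal{L}(X,Z)$. Then there exists $x_0\in M_T\cap E_X$ such that (i) $d(T,\mathcal{L}(X,Z))=\sup_{x\in S_X}d(Tx,Z)=d(Tx_0,Z)$; (ii) $Tx_0\perp_B Z^{\perp\perp}$; (iii) $T\perp_B\mathcal{L}(X,Z^{\perp\perp})$. -/

import Mathlib

set_option maxSynthPendingDepth 3

namespace BJMinimax

/-- A real normed space is reflexive if the canonical embedding into its bidual is onto. -/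
def IsReflexive (X : Type*) [NormedAddCommGroup X] [NormedSpace ℝ X] : Prop :=
  Function.Surjective (NormedSpace.inclusionInDoubleDual ℝ X)

/-- Birkhoff-James orthogonality `x ⊥_B y`. -/
def BJOrth {E : Type*} [NormedAddCommGroup E] [NormedSpace ℝ E] (x y : E) : Prop :=
  ∀ c : ℝ, ‖x‖ ≤ ‖x + c • y‖

/-- `x ⊥_B W` for a subspace `W`. -/
def BJOrthTo {E : Type*} [NormedAddCommGroup E] [NormedSpace ℝ E]
    (x : E) (W : Submodule ℝ E) : Prop :=
  ∀ w ∈ W, BJOrth x w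

/-- `J(x)`: the norm-one functionals `f` with `f x = ‖x‖`. -/
def supportFunctionals {E : Type*} [NormedAddCommGroup E] [NormedSpace ℝ E] (x : E) :
    Set (StrongDual ℝ E) :=
  {f | ‖f‖ = 1 ∧ f x = ‖x‖}

/-- A nonzero `x` is multi-smooth of finite order if the span of `J(x)` is finite-dimensional.
For operators this is applied with `E = X →L[ℝ] Y`. -/
def IsMultiSmooth {E : Type*} [NormedAddCommGroup E] [NormedSpace ℝ E] (x : E) : Prop :=
  x ≠ 0 ∧ FiniteDimensional ℝ (Submodule.span ℝ (supportFunctionals x))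

/-- `M_T`: the unit vectors at which `T` attains its norm. -/
def normAttainment {X Y : Type*} [NormedAddCommGroup X] [NormedSpace ℝ X]
    [NormedAddCommGroup Y] [NormedSpace ℝ Y] (T : X →L[ℝ] Y) : Set X :=
  {x | ‖x‖ = 1 ∧ ‖T x‖ = ‖T‖}

/-- `E_X`: the extreme points of the closed unit ball. -/
def extremeBall (X : Type*) [NormedAddCommGroup X] [NormedSpace ℝ X] : Set X :=
  (Metric.closedBall (0 : X) 1).extremePoints ℝ

/-- `ℒ(X, Z)` as a subspace of `ℒ(X, Y)`: the bounded operators with range in `Z`. -/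
def operatorsInto (X : Type*) {Y : Type*} [NormedAddCommGroup X] [NormedSpace ℝ X]
    [NormedAddCommGroup Y] [NormedSpace ℝ Y] (Z : Submodule ℝ Y) :
    Submodule ℝ (X →L[ℝ] Y) where
  carrier := {S | ∀ x, S x ∈ Z}
  zero_mem' := fun _ => Z.zero_mem
  add_mem' := fun hS hR x => Z.add_mem (hS x) (hR x)
  smul_mem' := fun c _ hS x => Z.smul_mem c (hS x)

/-- The annihilator `W^⊥` in the dual space: the functionals that vanish on `W`. -/
def annihilator {E : Type*} [NormedAddCommGroup E] [NormedSpace ℝ E]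
    (W : Submodule ℝ E) : Submodule ℝ (StrongDual ℝ E) where
  carrier := {f | ∀ w ∈ W, f w = 0}
  zero_mem' := fun _ _ => rfl
  add_mem' := fun hf hg w hw => by simp [hf w hw, hg w hw]
  smul_mem' := fun c _ hf w hw => by simp [hf w hw]

/-- `Z^⊥⊥`, a subspace of the bidual. -/
noncomputable def biannihilator {Y : Type*} [NormedAddCommGroup Y] [NormedSpace ℝ Y]
    (Z : Submodule ℝ Y) : Submodule ℝ (StrongDual ℝ (StrongDual ℝ Y)) :=
  annihilator (annihilator Z)

/-- `T` regarded as an operator into the bidual of `Y`. -/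
noncomputable def toBidual {X Y : Type*} [NormedAddCommGroup X] [NormedSpace ℝ X]
    [NormedAddCommGroup Y] [NormedSpace ℝ Y] (T : X →L[ℝ] Y) :
    X →L[ℝ] StrongDual ℝ (StrongDual ℝ Y) :=
  (NormedSpace.inclusionInDoubleDual ℝ Y).comp T

end BJMinimax

/-!
Since `T` is compact and `X` is reflexive, `(a, b) ↦ b (T a)` is continuous on the product of the
unit ball of `X` (weak topology) and the unit ball of `Y*` (weak-star topology). A compactness
argument then turns `T ⊥_B S`, for compact `S`, into a pair `(a, b)` with `b (T a) = ‖T‖` and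
`0 ≤ b (S a)`, and `a` can be moved to an extreme point `e` by maximising `b ∘ T` and then `b ∘ S`
over the unit ball: `‖T e‖ = ‖T‖ ≤ ‖T e + S e‖` for some extreme point `e`.

If no `T (x i)` were orthogonal to `Z`, there would be `z i ∈ Z` with `‖T (x i) + z i‖ < ‖T‖`, and a
finite-rank `S` into `Z` with `S (x i) = z i`, which exists by linear independence, would contradict
this. Finally, if `T x₀ ⊥_B Z`, then Hahn-Banach gives a functional in `Z^⊥` that norms `T x₀`, and
it witnesses the orthogonality to `Z^⊥⊥`.
-/

open Set

namespace BJMinimax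

section Distance

variable {E : Type*} [NormedAddCommGroup E] [NormedSpace ℝ E]

theorem BJOrthTo.infDist_eq_norm {y : E} {W : Submodule ℝ E} (h : BJOrthTo y W) :
    Metric.infDist y (W : Set E) = ‖y‖ := by
  refine le_antisymm ?_ ((Metric.le_infDist W.nonempty).2 fun w hw => ?_)
  · simpa only [dist_zero_right] using Metric.infDist_le_dist_of_mem (x := y) W.zero_mem
  · simpa only [dist_eq_norm, neg_smul, one_smul, ← sub_eq_add_neg] using h w hw (-1)

theorem exists_mem_annihilator_apply_eq_infDist (y : E) (W : Submodule ℝ E) :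
    ∃ f ∈ annihilator W, ‖f‖ ≤ 1 ∧ f y = Metric.infDist y (W : Set E) := by
  obtain ⟨g, hg, hgy⟩ := exists_dual_vector'' ℝ (W.mkQ y)
  have hmk : ‖W.mkQL‖ ≤ 1 := W.mkQL.opNorm_le_bound zero_le_one fun u =>
    (Submodule.Quotient.norm_mk_le W u).trans_eq (one_mul _).symm
  refine ⟨g ∘L W.mkQL, fun w hw => ?_, ?_, ?_⟩
  · have : W.mkQL w = 0 := (Submodule.Quotient.mk_eq_zero W).2 hw
    rw [ContinuousLinearMap.comp_apply, this, map_zero]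
  · exact (g.opNorm_comp_le _).trans (mul_le_one₀ hg (norm_nonneg _) hmk)
  · exact hgy.trans (QuotientAddGroup.norm_mk (S := W.toAddSubgroup) y)

theorem BJOrthTo.inclusionInDoubleDual {y : E} {W : Submodule ℝ E} (h : BJOrthTo y W) :
    BJOrthTo (NormedSpace.inclusionInDoubleDual ℝ E y) (biannihilator W) := by
  obtain ⟨f, hfW, hf, hfy⟩ := exists_mem_annihilator_apply_eq_infDist y W
  intro u hu c
  set ι := NormedSpace.inclusionInDoubleDual ℝ E
  calc ‖ι y‖ ≤ ‖y‖ := NormedSpace.double_dual_bound ℝ E y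
    _ = f y := by rw [hfy, h.infDist_eq_norm]
    _ = (ι y + c • u) f := by simp [ι, hu f hfW]
    _ ≤ ‖(ι y + c • u) f‖ := Real.le_norm_self _
    _ ≤ ‖ι y + c • u‖ := (ι y + c • u).unit_le_opNorm f hf

end Distance

section NormAttainment

variable {X Y : Type*} [NormedAddCommGroup X] [NormedSpace ℝ X]
  [NormedAddCommGroup Y] [NormedSpace ℝ Y] {T : X →L[ℝ] Y}

theorem normAttainment_toBidual (T : X →L[ℝ] Y) :
    normAttainment (toBidual T) = normAttainment T := by
  have hnorm : ‖toBidual T‖ = ‖T‖ :=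
    (NormedSpace.inclusionInDoubleDualLi (E := Y) ℝ).norm_toContinuousLinearMap_comp
  have happly (u : X) : ‖toBidual T u‖ = ‖T u‖ :=
    (NormedSpace.inclusionInDoubleDualLi (E := Y) ℝ).norm_map (T u)
  simp only [normAttainment, hnorm, happly]

theorem mem_normAttainment_of_opNorm_le (hT : T ≠ 0) {a : X} (ha : ‖a‖ ≤ 1) (hTa : ‖T‖ ≤ ‖T a‖) :
    a ∈ normAttainment T := by
  refine ⟨ha.antisymm ?_, (T.unit_le_opNorm a ha).antisymm hTa⟩
  exact (le_mul_iff_one_le_right (norm_pos_iff.2 hT)).1 (hTa.trans (T.le_opNorm a))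

variable {W : Submodule ℝ Y} {a : X}

theorem BJOrthTo.of_mem_normAttainment (ha : a ∈ normAttainment T) (h : BJOrthTo (T a) W) :
    BJOrthTo T (operatorsInto X W) := fun S hS c =>
  calc ‖T‖ = ‖T a‖ := ha.2.symm
    _ ≤ ‖T a + c • S a‖ := h (S a) (hS a) c
    _ ≤ ‖T + c • S‖ := (T + c • S).unit_le_opNorm a ha.1.le

theorem BJOrthTo.infDist_operatorsInto (ha : a ∈ normAttainment T) (h : BJOrthTo (T a) W) :
    Metric.infDist T (operatorsInto X W : Set (X →L[ℝ] Y)) =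
      Metric.infDist (T a) (W : Set Y) := by
  rw [(h.of_mem_normAttainment ha).infDist_eq_norm, h.infDist_eq_norm, ha.2]

theorem BJOrthTo.isLUB_infDist (ha : a ∈ normAttainment T) (h : BJOrthTo (T a) W) :
    IsLUB ((fun u => Metric.infDist (T u) (W : Set Y)) '' Metric.sphere (0 : X) 1)
      (Metric.infDist T (operatorsInto X W : Set (X →L[ℝ] Y))) := by
  refine IsGreatest.isLUB ⟨⟨a, mem_sphere_zero_iff_norm.2 ha.1, (h.infDist_operatorsInto ha).symm⟩,
    forall_mem_image.2 fun u hu => ?_⟩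
  calc Metric.infDist (T u) (W : Set Y) ≤ dist (T u) 0 := Metric.infDist_le_dist_of_mem W.zero_mem
    _ = ‖T u‖ := dist_zero_right _
    _ ≤ ‖T‖ := T.unit_le_opNorm u (mem_sphere_zero_iff_norm.1 hu).le
    _ = Metric.infDist T (operatorsInto X W : Set (X →L[ℝ] Y)) :=
      (h.of_mem_normAttainment ha).infDist_eq_norm.symm

end NormAttainment

section Compactness

/-- A maximiser of `f + t * g` has `0 ≤ g`, so the point sought is a maximiser of `f` over the set
where `0 ≤ g`. -/
theorem exists_eq_and_nonneg_of_forall_le_add_mul {α : Type*} [TopologicalSpace α] [T2Space α]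
    {K : Set α} (hK : IsCompact K) {f g : α → ℝ} (hf : ContinuousOn f K) (hg : ContinuousOn g K)
    {M : ℝ} (hfM : ∀ p ∈ K, f p ≤ M) (hM : ∀ t > 0, ∃ p ∈ K, M ≤ f p + t * g p) :
    ∃ p ∈ K, f p = M ∧ 0 ≤ g p := by
  set L := K ∩ g ⁻¹' Ici 0
  have hL : IsCompact L :=
    hK.of_isClosed_subset (hg.preimage_isClosed_of_isClosed hK.isClosed isClosed_Ici)
      inter_subset_left
  have hML : ∀ t > 0, ∃ q ∈ L, M ≤ f q + t * g q := fun t ht => by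
    obtain ⟨q, hqK, hq⟩ := hM t ht
    have : 0 ≤ t * g q := by linarith [hfM q hqK]
    exact ⟨q, ⟨hqK, nonneg_of_mul_nonneg_right this ht⟩, hq⟩
  obtain ⟨q, hqL, -⟩ := hML 1 one_pos
  obtain ⟨p, hpL, hp⟩ := hL.exists_isMaxOn ⟨q, hqL⟩ (hf.mono inter_subset_left)
  obtain ⟨C, hC⟩ := hK.exists_bound_of_continuousOn hg
  have hMp (t : ℝ) (ht : 0 < t) : M ≤ f p + t * C := by
    obtain ⟨q, hqL, hq⟩ := hML t ht
    have hgC : g q ≤ C := (Real.le_norm_self _).trans (hC q hqL.1)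
    exact hq.trans (add_le_add (hp hqL) (mul_le_mul_of_nonneg_left hgC ht.le))
  refine ⟨p, hpL.1, (hfM p hpL.1).antisymm ?_, hpL.2⟩
  have hlim : Filter.Tendsto (fun t : ℝ => f p + t * C) (nhdsWithin 0 (Ioi 0)) (nhds (f p)) := by
    have : Continuous fun t : ℝ => f p + t * C := by fun_prop
    simpa using (this.tendsto 0).mono_left nhdsWithin_le_nhds
  exact ge_of_tendsto hlim (eventually_mem_nhdsWithin.mono hMp)

theorem exists_mem_extremePoints_isMaxOn {E : Type*} [AddCommGroup E] [Module ℝ E]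
    [TopologicalSpace E] [T2Space E] [IsTopologicalAddGroup E] [ContinuousSMul ℝ E]
    [LocallyConvexSpace ℝ E] {s : Set E} (hs : IsCompact s) (φ ψ : StrongDual ℝ E) {v : E}
    (hv : v ∈ s) (hmax : IsMaxOn φ s v) :
    ∃ e ∈ s.extremePoints ℝ, φ v ≤ φ e ∧ ψ v ≤ ψ e := by
  set F := φ.toExposed s
  set G := ψ.toExposed F
  have hF : IsExposed ℝ s F := ContinuousLinearMap.toExposed.isExposed
  have hG : IsExposed ℝ F G := ContinuousLinearMap.toExposed.isExposed
  have hvF : v ∈ F := ⟨hv, hmax⟩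
  obtain ⟨z, hzF, hz⟩ :=
    (hF.isCompact hs).exists_isMaxOn ⟨v, hvF⟩ ψ.continuous.continuousOn
  obtain ⟨e, he⟩ := (hG.isCompact (hF.isCompact hs)).extremePoints_nonempty ⟨z, hzF, hz⟩
  exact ⟨e, (hF.isExtreme.trans hG.isExtreme).extremePoints_subset_extremePoints he,
    he.1.1.2 v hv, he.1.2 v hvF⟩

end Compactness

section WeakTopology

variable {X Y : Type*} [NormedAddCommGroup X] [NormedSpace ℝ X]
  [NormedAddCommGroup Y] [NormedSpace ℝ Y]

instance : T2Space (WeakSpace ℝ X) :=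
  (NormedSpace.isEmbedding_inclusionInDoubleDualWeak ℝ X).t2Space

instance : LocallyConvexSpace ℝ (WeakSpace ℝ X) :=
  inferInstanceAs (LocallyConvexSpace ℝ (WeakBilin (topDualPairing ℝ X).flip))

/-- A bounded functional on `X`, as a continuous functional on `X` with its weak topology. -/
noncomputable def weakFunctional (f : StrongDual ℝ X) : StrongDual ℝ (WeakSpace ℝ X) where
  toLinearMap := f.toLinearMap ∘ₗ (toWeakSpace ℝ X).symm.toLinearMap
  cont := WeakBilin.eval_continuous (topDualPairing ℝ X).flip f

/-- The closed unit ball of `X`, as a subset of `X` with its weak topology. -/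
def weakBall (X : Type*) [NormedAddCommGroup X] [NormedSpace ℝ X] : Set (WeakSpace ℝ X) :=
  toWeakSpace ℝ X '' Metric.closedBall 0 1

theorem toWeakSpace_mem_weakBall {a : X} : toWeakSpace ℝ X a ∈ weakBall X ↔ ‖a‖ ≤ 1 := by
  rw [weakBall, (toWeakSpace ℝ X).injective.mem_set_image, mem_closedBall_zero_iff]

/-- Weak compactness of the unit ball is Banach-Alaoglu in `X**`. -/
theorem IsReflexive.isCompact_weakBall (hX : IsReflexive X) : IsCompact (weakBall X) := by
  let ι := NormedSpace.inclusionInDoubleDualWeak ℝ X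
  let B := WeakDual.toStrongDual ⁻¹' Metric.closedBall (0 : StrongDual ℝ (StrongDual ℝ X)) 1
  have hpre : weakBall X = ι ⁻¹' B := by
    ext w
    obtain ⟨a, rfl⟩ := (toWeakSpace ℝ X).surjective w
    rw [toWeakSpace_mem_weakBall, mem_preimage, mem_preimage, mem_closedBall_zero_iff,
      ← (NormedSpace.inclusionInDoubleDualLi (E := X) ℝ).norm_map a]
    rfl
  have hrange : B ⊆ range ι := fun u _ =>
    let ⟨a, ha⟩ := hX (WeakDual.toStrongDual u)
    ⟨toWeakSpace ℝ X a, ha⟩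
  rw [hpre]
  exact (NormedSpace.isEmbedding_inclusionInDoubleDualWeak ℝ X).isCompact_preimage'
    (WeakDual.isCompact_closedBall _ _) hrange

/-- On a norm-compact set the weak and norm topologies agree. -/
theorem continuousOn_weakBall_of_isCompactOperator {T : X →L[ℝ] Y} (hT : IsCompactOperator T) :
    ContinuousOn (fun w => T ((toWeakSpace ℝ X).symm w)) (weakBall X) := by
  obtain ⟨K, hK, hTK⟩ := hT.image_closedBall_subset_compact 1
  have hmaps : MapsTo (fun w => T ((toWeakSpace ℝ X).symm w)) (weakBall X) K := by
    rintro _ ⟨a, ha, rfl⟩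
    exact hTK (mem_image_of_mem T ha)
  have : CompactSpace K := isCompact_iff_compactSpace.1 hK
  have hemb : Topology.IsClosedEmbedding fun y : K => toWeakSpace ℝ Y y :=
    Continuous.isClosedEmbedding ((toWeakSpaceCLM ℝ Y).continuous.comp continuous_subtype_val)
      ((toWeakSpace ℝ Y).injective.comp Subtype.val_injective)
  have hcont : Continuous hmaps.restrict :=
    hemb.continuous_iff.2 ((WeakSpace.map T).continuous.comp continuous_subtype_val)
  exact continuousOn_iff_continuous_domRestrict.2 (continuous_subtype_val.comp hcont)

/-- The closed unit ball of the dual of `Y`, as a subset of the dual with its weak-star topology. -/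
def weakStarBall (Y : Type*) [NormedAddCommGroup Y] [NormedSpace ℝ Y] : Set (WeakDual ℝ Y) :=
  WeakDual.toStrongDual ⁻¹' Metric.closedBall 0 1

theorem continuousOn_apply_univ_prod_weakStarBall :
    ContinuousOn (fun p : Y × WeakDual ℝ Y => p.2 p.1) (univ ×ˢ weakStarBall Y) := by
  refine continuousOn_prod_of_continuousOn_lipschitzOnWith _ 1
    (fun y _ => (WeakDual.eval_continuous y).continuousOn) fun b hb => ?_
  have hb1 : ‖WeakDual.toStrongDual b‖₊ ≤ 1 := mem_closedBall_zero_iff.1 hb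
  exact ((WeakDual.toStrongDual b).lipschitz.weaken hb1).lipschitzOnWith

theorem continuousOn_apply_apply_of_isCompactOperator {T : X →L[ℝ] Y} (hT : IsCompactOperator T) :
    ContinuousOn (fun p : WeakSpace ℝ X × WeakDual ℝ Y => p.2 (T ((toWeakSpace ℝ X).symm p.1)))
      (weakBall X ×ˢ weakStarBall Y) :=
  continuousOn_apply_univ_prod_weakStarBall.comp
    ((continuousOn_weakBall_of_isCompactOperator hT).prodMap continuousOn_id)
    fun _ hp => ⟨mem_univ _, hp.2⟩

theorem IsReflexive.exists_opNorm_le_norm_apply (hX : IsReflexive X) {T : X →L[ℝ] Y}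
    (hT : IsCompactOperator T) : ∃ a, ‖a‖ ≤ 1 ∧ ‖T‖ ≤ ‖T a‖ := by
  obtain ⟨_, ⟨a, ha, rfl⟩, hmax⟩ := hX.isCompact_weakBall.exists_isMaxOn
    ⟨_, toWeakSpace_mem_weakBall.2 (norm_zero.trans_le zero_le_one)⟩
    (continuousOn_weakBall_of_isCompactOperator hT).norm
  refine ⟨a, mem_closedBall_zero_iff.1 ha, ?_⟩
  refine T.opNorm_le_of_unit_norm (norm_nonneg _) fun u hu => ?_
  exact hmax (toWeakSpace_mem_weakBall.2 hu.le)

theorem IsReflexive.exists_mem_extremeBall_isMaxOn (hX : IsReflexive X) (φ ψ : StrongDual ℝ X)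
    {v : X} (hv : ‖v‖ ≤ 1) (hmax : ∀ w, ‖w‖ ≤ 1 → φ w ≤ φ v) :
    ∃ e ∈ extremeBall X, φ v ≤ φ e ∧ ψ v ≤ ψ e := by
  obtain ⟨e, he, hφ, hψ⟩ := exists_mem_extremePoints_isMaxOn hX.isCompact_weakBall
    (weakFunctional φ) (weakFunctional ψ) (toWeakSpace_mem_weakBall.2 hv)
    (forall_mem_image.2 fun w hw => hmax w (mem_closedBall_zero_iff.1 hw))
  rw [weakBall, ← image_extremePoints] at he
  obtain ⟨e, he, rfl⟩ := he
  exact ⟨e, he, hφ, hψ⟩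

end WeakTopology

section Orthogonality

variable {X Y : Type*} [NormedAddCommGroup X] [NormedSpace ℝ X]
  [NormedAddCommGroup Y] [NormedSpace ℝ Y] {T S : X →L[ℝ] Y}

theorem apply_le_norm_of_norm_le_one {b : StrongDual ℝ Y} (hb : ‖b‖ ≤ 1) (y : Y) : b y ≤ ‖y‖ :=
  (Real.le_norm_self _).trans ((b.le_of_opNorm_le hb y).trans_eq (one_mul _))

theorem BJOrth.exists_norming_pair (hX : IsReflexive X) (hT : IsCompactOperator T)
    (hS : IsCompactOperator S) (hTS : BJOrth T S) :
    ∃ a : X, ∃ b : StrongDual ℝ Y, ‖a‖ ≤ 1 ∧ ‖b‖ ≤ 1 ∧ b (T a) = ‖T‖ ∧ 0 ≤ b (S a) := by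
  have hle : ∀ p ∈ weakBall X ×ˢ weakStarBall Y, p.2 (T ((toWeakSpace ℝ X).symm p.1)) ≤ ‖T‖ := by
    rintro ⟨_, b⟩ ⟨⟨a, ha, rfl⟩, hb⟩
    exact (apply_le_norm_of_norm_le_one (mem_closedBall_zero_iff.1 hb) _).trans
      (T.unit_le_opNorm a (mem_closedBall_zero_iff.1 ha))
  have hge : ∀ t > (0 : ℝ), ∃ p ∈ weakBall X ×ˢ weakStarBall Y,
      ‖T‖ ≤ p.2 (T ((toWeakSpace ℝ X).symm p.1)) + t * p.2 (S ((toWeakSpace ℝ X).symm p.1)) := by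
    intro t _
    have hcomp : IsCompactOperator (T + t • S) := hT.add (hS.smul t)
    obtain ⟨a, ha, hTSa⟩ := hX.exists_opNorm_le_norm_apply hcomp
    obtain ⟨b, hb, hba⟩ := exists_dual_vector'' ℝ ((T + t • S) a)
    refine ⟨(toWeakSpace ℝ X a, StrongDual.toWeakDual b),
      ⟨toWeakSpace_mem_weakBall.2 ha, mem_closedBall_zero_iff.2 hb⟩, ?_⟩
    calc ‖T‖ ≤ ‖T + t • S‖ := hTS t
      _ ≤ b ((T + t • S) a) := hTSa.trans_eq hba.symm
      _ = b (T a) + t * b (S a) := by simp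
  obtain ⟨⟨_, b⟩, ⟨⟨a, ha, rfl⟩, hb⟩, hTab, hSab⟩ := exists_eq_and_nonneg_of_forall_le_add_mul
    (hX.isCompact_weakBall.prod (WeakDual.isCompact_closedBall 0 1))
    (continuousOn_apply_apply_of_isCompactOperator hT)
    (continuousOn_apply_apply_of_isCompactOperator hS) hle hge
  exact ⟨a, WeakDual.toStrongDual b, mem_closedBall_zero_iff.1 ha, mem_closedBall_zero_iff.1 hb,
    hTab, hSab⟩

theorem BJOrth.exists_extreme_norm_apply_le (hX : IsReflexive X) (hT0 : T ≠ 0)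
    (hT : IsCompactOperator T) (hS : IsCompactOperator S) (hTS : BJOrth T S) :
    ∃ e ∈ normAttainment T ∩ extremeBall X, ‖T‖ ≤ ‖T e + S e‖ := by
  obtain ⟨a, b, ha, hb, hTa, hSa⟩ := hTS.exists_norming_pair hX hT hS
  have hb' := apply_le_norm_of_norm_le_one hb
  obtain ⟨e, he, hTe, hSe⟩ := hX.exists_mem_extremeBall_isMaxOn (b ∘L T) (b ∘L S) ha
    fun w hw => ((hb' _).trans (T.unit_le_opNorm w hw)).trans_eq hTa.symm
  simp only [ContinuousLinearMap.comp_apply, hTa] at hTe hSe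
  have heM : e ∈ normAttainment T := mem_normAttainment_of_opNorm_le hT0
    (mem_closedBall_zero_iff.1 he.1) (hTe.trans (hb' _))
  refine ⟨e, ⟨heM, he⟩, ?_⟩
  calc ‖T‖ ≤ b (T e) + b (S e) := by linarith
    _ = b (T e + S e) := (map_add b _ _).symm
    _ ≤ ‖T e + S e‖ := hb' _

theorem exists_isCompactOperator_apply_eq {ι : Type*} [Finite ι] {x : ι → X}
    (hx : LinearIndependent ℝ x) (y : ι → Y) :
    ∃ R : X →L[ℝ] Y, IsCompactOperator R ∧ ∀ i, R (x i) = y i := by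
  let V := Submodule.span ℝ (range x)
  have : FiniteDimensional ℝ V := FiniteDimensional.span_of_finite ℝ (finite_range x)
  obtain ⟨p, hp⟩ := Submodule.ClosedComplemented.of_finiteDimensional V
  let basis := Module.Basis.span hx
  let g : V →L[ℝ] Y := (basis.constr ℝ y).toContinuousLinearMap
  refine ⟨g ∘L p, ((isCompactOperator_id (E := V)).comp_clm p).clm_comp g, fun i => ?_⟩
  have hxi : (basis i : X) = x i := Module.Basis.span_apply hx i ▸ rfl
  rw [← hxi, ContinuousLinearMap.comp_apply, hp]
  exact basis.constr_basis ℝ y i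

theorem exists_bjOrthTo_apply (hX : IsReflexive X) {Z : Submodule ℝ Y}
    (hT0 : T ≠ 0) (hT : IsCompactOperator T) {ι : Type*} [Finite ι] {x : ι → X}
    (hx : LinearIndependent ℝ x)
    (hM : normAttainment T ∩ extremeBall X = {v | ∃ i, v = x i ∨ v = -x i})
    (hTZ : ∀ S ∈ operatorsInto X Z, IsCompactOperator S → BJOrth T S) :
    ∃ x₀ ∈ normAttainment T ∩ extremeBall X, BJOrthTo (T x₀) Z := by
  by_contra! hnot
  have hz (i : ι) : ∃ z : Z, ‖T (x i) + z‖ < ‖T‖ := by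
    have hxi : x i ∈ normAttainment T ∩ extremeBall X := hM.symm.subset ⟨i, Or.inl rfl⟩
    obtain ⟨z, hzZ, c, hc⟩ : ∃ z ∈ Z, ∃ c : ℝ, ‖T (x i) + c • z‖ < ‖T (x i)‖ := by
      simpa only [BJOrthTo, BJOrth, not_forall, not_le, exists_prop] using hnot (x i) hxi
    exact ⟨⟨c • z, Z.smul_mem c hzZ⟩, hc.trans_eq hxi.1.2⟩
  choose z hz using hz
  obtain ⟨R, hR, hRx⟩ := exists_isCompactOperator_apply_eq hx z
  let S := Z.subtypeL ∘L R
  have hSx (i : ι) : S (x i) = z i := congrArg Subtype.val (hRx i)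
  have hTS : BJOrth T S := hTZ S (fun u => (R u).2) (hR.clm_comp Z.subtypeL)
  obtain ⟨e, heM, he⟩ := hTS.exists_extreme_norm_apply_le hX hT0 hT (hR.clm_comp Z.subtypeL)
  obtain ⟨i, rfl | rfl⟩ := hM.subset heM
  · exact (hz i).not_ge (hSx i ▸ he)
  · rw [map_neg, map_neg, ← neg_add, norm_neg, hSx] at he
    exact (hz i).not_ge he

end Orthogonality

end BJMinimax

theorem theorem2p8_general {X Y : Type*}
    [NormedAddCommGroup X] [NormedSpace ℝ X] [NormedAddCommGroup Y] [NormedSpace ℝ Y]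
    (hX : BJMinimax.IsReflexive X) (Z : Submodule ℝ Y)
    (T : X →L[ℝ] Y) (hT0 : T ≠ 0) (hT : IsCompactOperator T)
    {ι : Type*} [Finite ι] (x : ι → X) (hx : LinearIndependent ℝ x)
    (hM : BJMinimax.normAttainment T ∩ BJMinimax.extremeBall X =
      {v | ∃ i, v = x i ∨ v = -x i})
    (hTZ : ∀ S ∈ BJMinimax.operatorsInto X Z, IsCompactOperator S → BJMinimax.BJOrth T S) :
    ∃ x₀ ∈ BJMinimax.normAttainment T ∩ BJMinimax.extremeBall X,
      (IsLUB ((fun u => Metric.infDist (T u) (Z : Set Y)) '' Metric.sphere (0 : X) 1)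
          (Metric.infDist T (BJMinimax.operatorsInto X Z : Set (X →L[ℝ] Y))) ∧
        Metric.infDist T (BJMinimax.operatorsInto X Z : Set (X →L[ℝ] Y)) =
          Metric.infDist (T x₀) (Z : Set Y)) ∧
      BJMinimax.BJOrthTo (NormedSpace.inclusionInDoubleDual ℝ Y (T x₀))
        (BJMinimax.biannihilator Z) ∧
      BJMinimax.BJOrthTo (BJMinimax.toBidual T)
        (BJMinimax.operatorsInto X (BJMinimax.biannihilator Z)) := by
  obtain ⟨x₀, hx₀, horth⟩ := BJMinimax.exists_bjOrthTo_apply hX hT0 hT hx hM hTZ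
  have hbidual : x₀ ∈ BJMinimax.normAttainment (BJMinimax.toBidual T) :=
    (BJMinimax.normAttainment_toBidual T).symm ▸ hx₀.1
  have horth' := horth.inclusionInDoubleDual
  exact ⟨x₀, hx₀, ⟨horth.isLUB_infDist hx₀.1, horth.infDist_operatorsInto hx₀.1⟩, horth',
    horth'.of_mem_normAttainment hbidual⟩

theorem theorem2p8 {X Y : Type*}
    [NormedAddCommGroup X] [NormedSpace ℝ X] [CompleteSpace X]
    [NormedAddCommGroup Y] [NormedSpace ℝ Y] [CompleteSpace Y]
    (hX : BJMinimax.IsReflexive X)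
    (Z : Submodule ℝ Y) (hZ : IsClosed (Z : Set Y))
    (T : X →L[ℝ] Y) (hT : IsCompactOperator T) (hsmooth : BJMinimax.IsMultiSmooth T)
    (n : ℕ) (x : Fin n → X) (hx : LinearIndependent ℝ x)
    (hM : BJMinimax.normAttainment T ∩ BJMinimax.extremeBall X =
      {v | ∃ i, v = x i ∨ v = -x i})
    (hTZ : BJMinimax.BJOrthTo T (BJMinimax.operatorsInto X Z)) :
    ∃ x₀ ∈ BJMinimax.normAttainment T ∩ BJMinimax.extremeBall X,
      (IsLUB ((fun u => Metric.infDist (T u) (Z : Set Y)) '' Metric.sphere (0 : X) 1)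
          (Metric.infDist T (BJMinimax.operatorsInto X Z : Set (X →L[ℝ] Y))) ∧
        Metric.infDist T (BJMinimax.operatorsInto X Z : Set (X →L[ℝ] Y)) =
          Metric.infDist (T x₀) (Z : Set Y)) ∧
      BJMinimax.BJOrthTo (NormedSpace.inclusionInDoubleDual ℝ Y (T x₀))
        (BJMinimax.biannihilator Z) ∧
      BJMinimax.BJOrthTo (BJMinimax.toBidual T)
        (BJMinimax.operatorsInto X (BJMinimax.biannihilator Z)) := by
  exact theorem2p8_general hX Z T hsmooth.1 hT x hx hM fun S hS _ => hTZ S hS
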